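/- Let $0<\alpha<1$ and $\beta>0$, and for $n\geq 1$ put $p_{\pm 2n}=(2n)^{-\alpha-1}$ and $p_{\pm(2n-1)}=(2n-1)^{-\beta-1}$. (i) Let $\{L_t\}_{t\geq0}$ be a one-dimensional symmetric Lévy process ($L_0=0$ a.s., stationary and independent increments, a.s. càdlàg paths, and $\{L_t\}$ and $\{-L_t\}$ have the same finite-dimensional distributions) whose Lévy measure is the measure $\nu$ concentrated on $\mathbb{Z}\setminus\{0\}$ with $\nu(\{n\})=p_n$ for all $n\neq0$. Then $\{L_t\}_{t\geq0}$ is transient, that is, $\mathbb{P}(\lim_{t\to\infty}|L_t|=\infty)=1$. (ii) Let $p_0\geq0$ (for instance $p_0=0$), let $c=\sum_{n\in\mathbb{Z}}p_n$, and let $S_0=0$, $S_n=J_1+\dots+J_n$ be a random walk on $\mathbb{Z}$ with i.i.d. jumps satisfying $\mathbb{P}(J_1=n)=c^{-1}p_n$ for all $n\in\mathbb{Z}$. Then the walk is transient: $\mathbb{P}(\lim_{n\to\infty}|S_n|=\infty)=1$, and, as a Markov chain, $\sum_{n\geq1}\mathbb{P}(S_n=u\mid S_0=u)<\infty$ for every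 $u\in\mathbb{Z}$. (iii) The condition $\sum_{n\geq1}\frac{1}{n^{3}q_n}<\infty$ (the sufficient condition for transience of symmetric Lévy processes with Lévy measure $\nu(\{n\})=q_n$, respectively of symmetric random walks on $\mathbb{Z}$ with $\mathbb{P}(J_1=n)=q_n$) holds with $q_n=p_n$, and equally with $q_n=c^{-1}p_n$, if and only if $\beta<1$. In particular, if $\beta\geq1$ it fails although the process and the walk are transient, so that the condition is not necessary for transience. -/

import Mathlib

open MeasureTheory ProbabilityTheory Filter Topology
open scoped NNReal ENNReal

/-- A path is càdlàg: right-continuous with (finite) left limits. -/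
def IsCadlagPath (x : ℝ≥0 → ℝ) : Prop :=
  ∀ t : ℝ≥0, Tendsto x (𝓝[>] t) (𝓝 (x t)) ∧ ∃ l : ℝ, Tendsto x (𝓝[<] t) (𝓝 l)

/-- A one-dimensional Lévy process: it starts at `0` almost surely, has independent and stationary
increments, and has almost surely càdlàg paths. -/
structure IsLevyProcess {Ω : Type*} [MeasurableSpace Ω] (L : ℝ≥0 → Ω → ℝ) (P : Measure Ω) :
    Prop where
  measurable : ∀ t, Measurable (L t)
  zero : ∀ᵐ ω ∂P, L 0 ω = 0
  indep : HasIndepIncrements L P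
  stationary : ∀ s t : ℝ≥0, IdentDistrib (fun ω => L (s + t) ω - L s ω) (fun ω => L t ω - L 0 ω) P P
  cadlag : ∀ᵐ ω ∂P, IsCadlagPath (fun t => L t ω)

/-- A stochastic process is symmetric if it has the same finite-dimensional distributions as its
negative. -/
def IsSymmetricProcess {T Ω : Type*} [MeasurableSpace Ω] (X : T → Ω → ℝ) (P : Measure Ω) : Prop :=
  ∀ I : Finset T,
    P.map (fun ω => I.restrict (fun t => X t ω)) = P.map (fun ω => I.restrict (fun t => -X t ω))

/-- Lévy measures on `ℝ`. -/
structure IsLevyMeasure (ν : Measure ℝ) : Prop where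
  sigmaFinite : SigmaFinite ν
  zero : ν {0} = 0
  lintegral_lt_top : ∫⁻ y, ENNReal.ofReal (min 1 (y ^ 2)) ∂ν < ∞

/-- The characteristic exponent
`ψ(ξ) = i ξ b + c ξ² / 2 + ∫ (1 - exp (i ξ y) + i ξ y 1_{|y| ≤ 1}) ν(dy)`
of the Lévy triplet `(b, c, ν)`. -/
noncomputable def levyExponent (b c : ℝ) (ν : Measure ℝ) (ξ : ℝ) : ℂ :=
  Complex.I * ξ * b + c * ξ ^ 2 / 2 +
    ∫ y : ℝ, (1 - Complex.exp (Complex.I * ξ * y) +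
      Complex.I * ξ * ((if |y| ≤ 1 then y else 0 : ℝ) : ℂ)) ∂ν

/-- `(b, c, ν)` is the Lévy triplet of the process `L`: the Lévy-Khintchine formula
`E[exp (i ξ L_t)] = exp (-t ψ(ξ))` holds. -/
structure HasLevyTriplet {Ω : Type*} [MeasurableSpace Ω] (L : ℝ≥0 → Ω → ℝ) (P : Measure Ω)
    (b c : ℝ) (ν : Measure ℝ) : Prop where
  nonneg : 0 ≤ c
  isLevyMeasure : IsLevyMeasure ν
  charFun_eq : ∀ (t : ℝ≥0) (ξ : ℝ),
    ∫ ω, Complex.exp (Complex.I * ξ * L t ω) ∂P = Complex.exp (-(t : ℂ) * levyExponent b c ν ξ)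

/-- `ν` is the Lévy measure of `L`. -/
def HasLevyMeasure {Ω : Type*} [MeasurableSpace Ω] (L : ℝ≥0 → Ω → ℝ) (P : Measure Ω)
    (ν : Measure ℝ) : Prop :=
  ∃ b c : ℝ, HasLevyTriplet L P b c ν

/-- Random variables `J 0, J 1, …` are the jumps of a random walk on `ℤ`: they are independent and
identically distributed. -/
structure AreJumps {Ω : Type*} [MeasurableSpace Ω] (J : ℕ → Ω → ℤ) (P : Measure Ω) : Prop where
  measurable : ∀ n, Measurable (J n)
  indep : iIndepFun J P
  identDistrib : ∀ n, IdentDistrib (J n) (J 0) P P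

/-- The random walk on `ℤ` with jumps `J`, started at `0`: the sum of the first `n` jumps. -/
def randomWalk {Ω : Type*} (J : ℕ → Ω → ℤ) (n : ℕ) (ω : Ω) : ℤ :=
  ∑ i ∈ Finset.range n, J i ω

/-- A process (in discrete or continuous time) is transient if `|X_t| → ∞` almost surely. -/
def IsTransient {T Ω : Type*} [Preorder T] [MeasurableSpace Ω] (X : T → Ω → ℝ) (P : Measure Ω) :
    Prop :=
  ∀ᵐ ω ∂P, Tendsto (fun t => |X t ω|) atTop atTop

/-- The random walk with jumps `J` is transient as a Markov chain: every state `u ∈ ℤ` is transient,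
that is, for the walk `u + S_n` started at `u`, the sum over `n ≥ 1` of the probabilities of being
at `u` at time `n` is finite. -/
def IsTransientChain {Ω : Type*} [MeasurableSpace Ω] (J : ℕ → Ω → ℤ) (P : Measure Ω) : Prop :=
  ∀ u : ℤ, Summable fun n : ℕ => P.real {ω | u + randomWalk J (n + 1) ω = u}

/-- The symmetric weights on `ℤ` with `p_{±2n} = (2n)^{-α-1}` and `p_{±(2n-1)} = (2n-1)^{-β-1}` for
`n ≥ 1`, and the value `p₀` at `0`. -/
noncomputable def multiWeight (α β p₀ : ℝ) (n : ℤ) : ℝ :=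
  if n = 0 then p₀ else if Even n then |(n : ℝ)| ^ (-α - 1) else |(n : ℝ)| ^ (-β - 1)

/-- The measure on `ℝ` concentrated on `ℤ \ {0}` with mass `p_n` at each `n ≠ 0`. -/
noncomputable def multiLevyMeasure (α β : ℝ) : Measure ℝ :=
  Measure.sum fun n : ℤ => ENNReal.ofReal (multiWeight α β 0 n) • Measure.dirac (n : ℝ)

/-- The condition `∑_{n ≥ 1} 1 / (n³ q_n) < ∞`. -/
def CubicCondition (q : ℤ → ℝ) : Prop :=
  Summable fun n : ℕ => 1 / (((n : ℝ) + 1) ^ 3 * q ((n : ℤ) + 1))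

/-! Transience is a Chung–Fuchs estimate that uses only the even weights. Cutting the sum at `n ≤
2/ξ` shows that they alone contribute at least a multiple of `ξ ^ α` to `∑ p_n (1 - cos (ξ n))`, and
the other weights only add nonnegative terms, whatever `β > 0` is. So `1 - Re z(ξ) ≥ c ξ ^ α` near
`0`, where `z` is the characteristic function of one jump, or of `L 1`. Summing the geometric series
of powers of `z` bounds the expected number of visits to a bounded interval by a multiple of `∫ ξ ^
(-α) dξ` near `0`, which is finite because `α < 1` (`summable_measureReal_abs_le`). Borel–Cantelli
then settles the walk.

For the Lévy process the same argument applies to the skeleton at integer times. A first-passage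
inequality (`measureReal_exists_abs_sum_le`) along dyadic times bounds the probability of a visit
during `[n, n + 1]` by that of `L (n + 1)` lying in a larger interval, and right-continuity passes
from dyadic times to all times.

The cubic condition, by contrast, sees every weight: its terms are `n ^ (α - 2)` for even `n` and `n
^ (β - 2)` for odd `n`, so it holds exactly when `β < 1`. -/

/-! ### Expected visits to intervals, through characteristic functions -/

lemma integral_triangle_mul_cos {δ x : ℝ} (hδ : 0 < δ) (hx : x ≠ 0) :
    ∫ ξ in (0 : ℝ)..δ, (1 - ξ / δ) * Real.cos (ξ * x) = (1 - Real.cos (δ * x)) / (δ * x ^ 2) := by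
  have key : ∀ ξ ∈ Set.uIcc 0 δ, HasDerivAt
      (fun ξ : ℝ => (1 - ξ / δ) * (Real.sin (ξ * x) / x) - Real.cos (ξ * x) / (δ * x ^ 2))
      ((1 - ξ / δ) * Real.cos (ξ * x)) ξ := by
    intro ξ _
    have h0 : HasDerivAt (fun ξ : ℝ => ξ * x) x ξ := by simpa using (hasDerivAt_id ξ).mul_const x
    have h1 : HasDerivAt (fun ξ : ℝ => 1 - ξ / δ) (-(1 / δ)) ξ := by
      simpa using ((hasDerivAt_id ξ).div_const δ).const_sub 1
    have h2 := (h1.mul (h0.sin.div_const x)).sub (h0.cos.div_const (δ * x ^ 2))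
    refine h2.congr_deriv ?_
    field_simp
    ring
  rw [intervalIntegral.integral_eq_sub_of_hasDerivAt key
    (Continuous.intervalIntegrable (by fun_prop) _ _)]
  simp only [div_self hδ.ne', zero_mul, Real.cos_zero, Real.sin_zero]
  field_simp
  ring

lemma integral_triangle {δ : ℝ} (hδ : 0 < δ) : ∫ ξ in (0 : ℝ)..δ, (1 - ξ / δ) = δ / 2 := by
  rw [intervalIntegral.integral_sub (by simp) (Continuous.intervalIntegrable (by fun_prop) _ _),
    intervalIntegral.integral_div]
  simp
  field_simp
  ring

/-- This sign is the reason for the triangular weight: its cosine transform is a Fejér kernel,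
whereas a sharp cutoff would give `sin (δ x) / x`, which changes sign. -/
lemma integral_triangle_mul_cos_nonneg {δ : ℝ} (hδ : 0 < δ) (x : ℝ) :
    0 ≤ ∫ ξ in (0 : ℝ)..δ, (1 - ξ / δ) * Real.cos (ξ * x) := by
  rcases eq_or_ne x 0 with rfl | hx
  · simp only [mul_zero, Real.cos_zero, mul_one, integral_triangle hδ]
    positivity
  · rw [integral_triangle_mul_cos hδ hx]
    have := Real.cos_le_one (δ * x)
    exact div_nonneg (by linarith) (by positivity)

lemma le_integral_triangle_mul_cos {δ x : ℝ} (hδ : 0 < δ) (hx : |x| ≤ 1 / δ) :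
    δ / 4 ≤ ∫ ξ in (0 : ℝ)..δ, (1 - ξ / δ) * Real.cos (ξ * x) := by
  -- Here `|ξ x| ≤ 1`, so the cosine is at least `1 / 2`, and the triangle has mass `δ / 2`.
  have h : ∫ ξ in (0 : ℝ)..δ, (1 - ξ / δ) * (1 / 2) ≤
      ∫ ξ in (0 : ℝ)..δ, (1 - ξ / δ) * Real.cos (ξ * x) := by
    refine intervalIntegral.integral_mono_on hδ.le
      (Continuous.intervalIntegrable (by fun_prop) _ _)
      (Continuous.intervalIntegrable (by fun_prop) _ _) fun ξ hξ => ?_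
    have h1 : 0 ≤ 1 - ξ / δ := by
      have := (div_le_one hδ).2 hξ.2
      linarith
    refine mul_le_mul_of_nonneg_left ?_ h1
    have h2 : |ξ * x| ≤ 1 := by
      rw [abs_mul, abs_of_nonneg hξ.1]
      calc ξ * |x| ≤ δ * (1 / δ) := mul_le_mul hξ.2 hx (abs_nonneg _) hδ.le
        _ = 1 := by field_simp
    have h3 := Real.one_sub_sq_div_two_le_cos (x := ξ * x)
    have h4 : (ξ * x) ^ 2 ≤ 1 := (sq_le_one_iff_abs_le_one _).2 h2
    linarith
  rw [intervalIntegral.integral_mul_const, integral_triangle hδ] at h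
  linarith

section

variable {Ω : Type*} [MeasurableSpace Ω] {P : Measure Ω} [IsProbabilityMeasure P]

lemma re_charFun_map {X : Ω → ℝ} (hX : Measurable X) (ξ : ℝ) :
    (charFun (P.map X) ξ).re = ∫ ω, Real.cos (ξ * X ω) ∂P := by
  have hi : Integrable (fun ω => Complex.exp (ξ * X ω * Complex.I)) P := by
    refine Integrable.of_bound (by fun_prop) 1 (ae_of_all _ fun ω => ?_)
    rw [← Complex.ofReal_mul, Complex.norm_exp_ofReal_mul_I]
  rw [charFun_apply_real, integral_map hX.aemeasurable (by fun_prop)]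
  have := integral_re hi
  simp only [RCLike.re_to_complex] at this
  rw [← this]
  congr with ω
  rw [← Complex.ofReal_mul, Complex.exp_ofReal_mul_I_re]

/-- A small-ball bound through the characteristic function. -/
lemma measureReal_abs_le_mul_le {X : Ω → ℝ} (hX : Measurable X) {δ : ℝ} (hδ : 0 < δ) :
    P.real {ω | |X ω| ≤ 1 / δ} * (δ / 4) ≤
      ∫ ξ in (0 : ℝ)..δ, (1 - ξ / δ) * (charFun (P.map X) ξ).re := by
  have hint : Integrable (Function.uncurry fun (ω : Ω) (ξ : ℝ) =>
      (1 - ξ / δ) * Real.cos (ξ * X ω)) (P.prod (volume.restrict (Set.Ioc 0 δ))) := by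
    refine Integrable.of_bound (Measurable.aestronglyMeasurable (by fun_prop)) 1 ?_
    have : ∀ᵐ p ∂(P.prod (volume.restrict (Set.Ioc 0 δ))), p.2 ∈ Set.Ioc 0 δ :=
      Measure.quasiMeasurePreserving_snd.ae (ae_restrict_mem measurableSet_Ioc)
    filter_upwards [this] with p hp
    simp only [Function.uncurry, norm_mul, Real.norm_eq_abs]
    have h1 : |1 - p.2 / δ| ≤ 1 := by
      have h2 := (div_le_one hδ).2 hp.2
      have h3 := div_pos hp.1 hδ
      rw [abs_le]; constructor <;> linarith
    exact mul_le_one₀ h1 (abs_nonneg _) (Real.abs_cos_le_one _)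
  have hswap : ∫ ω, (∫ ξ in (0 : ℝ)..δ, (1 - ξ / δ) * Real.cos (ξ * X ω)) ∂P =
      ∫ ξ in (0 : ℝ)..δ, (1 - ξ / δ) * (charFun (P.map X) ξ).re := by
    simp only [intervalIntegral.integral_of_le hδ.le]
    rw [integral_integral_swap hint]
    congr with ξ
    rw [integral_const_mul, re_charFun_map hX]
  rw [← hswap]
  have hset : MeasurableSet {ω | |X ω| ≤ 1 / δ} := measurableSet_le (by fun_prop) (by fun_prop)
  have hint2 : Integrable (fun ω => ∫ ξ in (0 : ℝ)..δ, (1 - ξ / δ) * Real.cos (ξ * X ω)) P := by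
    simp only [intervalIntegral.integral_of_le hδ.le]
    exact hint.integral_prod_left
  calc P.real {ω | |X ω| ≤ 1 / δ} * (δ / 4)
      = ∫ ω, {ω | |X ω| ≤ 1 / δ}.indicator (fun _ => δ / 4) ω ∂P := by
        rw [integral_indicator hset]; simp
    _ ≤ _ := by
        refine integral_mono ((integrable_const _).indicator hset) hint2 fun ω => ?_
        by_cases hω : |X ω| ≤ 1 / δ
        · rw [Set.indicator_of_mem (show ω ∈ {ω | |X ω| ≤ 1 / δ} from hω)]
          exact le_integral_triangle_mul_cos hδ hω
        · rw [Set.indicator_of_notMem (show ω ∉ {ω | |X ω| ≤ 1 / δ} from hω)]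
          exact integral_triangle_mul_cos_nonneg hδ _

/-- If the characteristic functions of `X n` are the powers of a function `z` with
`1 - Re z(ξ) ≥ c ξ ^ α` near `0`, where `α < 1`, then bounded intervals are visited only finitely
often in the mean. -/
lemma summable_measureReal_abs_le {X : ℕ → Ω → ℝ} (hX : ∀ n, Measurable (X n)) {z : ℝ → ℂ}
    (hz : ∀ n ξ, charFun (P.map (X n)) ξ = z ξ ^ n) {c α : ℝ} (hc : 0 < c) (hα : α < 1)
    (hbound : ∀ ξ, 0 < ξ → ξ ≤ 1 → c * ξ ^ α ≤ 1 - (z ξ).re) (R : ℝ) :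
    Summable fun n => P.real {ω | |X n ω| ≤ R} := by
  -- This choice gives both `R ≤ 1 / δ` and `δ ≤ 1`, the range where `hbound` applies.
  set δ : ℝ := 1 / (|R| + 1) with hδdef
  have hδ : 0 < δ := by positivity
  have hδ1 : δ ≤ 1 := by
    rw [hδdef, div_le_one (by positivity)]
    linarith [abs_nonneg R]
  have hRδ : R ≤ 1 / δ := by
    rw [hδdef, one_div_one_div]
    linarith [le_abs_self R]
  have hznorm : ∀ ξ, ‖z ξ‖ ≤ 1 := fun ξ => by
    have := Measure.isProbabilityMeasure_map (μ := P) (hX 1).aemeasurable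
    have := hz 1 ξ
    rw [pow_one] at this
    rw [← this]
    exact norm_charFun_le_one _
  -- The geometric sum is `(z ^ N - 1) / (z - 1)`; its numerator has norm at most `2` and its
  -- denominator at least `1 - Re z`, so the bound is uniform in `N`.
  have hgeom : ∀ N ξ, 0 < ξ → ξ ≤ 1 →
      ∑ n ∈ Finset.range N, (charFun (P.map (X n)) ξ).re ≤ 2 / c * ξ ^ (-α) := by
    intro N ξ h0 h1
    have hpos : 0 < c * ξ ^ α := mul_pos hc (Real.rpow_pos_of_pos h0 _)
    have hb := hbound ξ h0 h1
    have hne : z ξ ≠ 1 := by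
      intro h
      rw [h] at hb
      simp at hb
      linarith
    rw [← Complex.re_sum, Finset.sum_congr rfl fun n _ => hz n ξ, geom_sum_eq hne]
    refine (Complex.re_le_norm _).trans ?_
    rw [norm_div, Real.rpow_neg h0.le]
    have h2 : ‖z ξ ^ N - 1‖ ≤ 2 := by
      refine (norm_sub_le _ _).trans ?_
      rw [norm_pow, norm_one]
      linarith [pow_le_one₀ (norm_nonneg (z ξ)) (hznorm ξ) (n := N)]
    have h3 : c * ξ ^ α ≤ ‖z ξ - 1‖ := by
      rw [norm_sub_rev]
      refine hb.trans ?_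
      simpa using Complex.re_le_norm (1 - z ξ)
    calc ‖z ξ ^ N - 1‖ / ‖z ξ - 1‖ ≤ 2 / (c * ξ ^ α) := by gcongr
      _ = _ := by field_simp
  have hcont : ∀ n, Continuous fun ξ : ℝ => (charFun (P.map (X n)) ξ).re := fun n => by
    have := Measure.isProbabilityMeasure_map (μ := P) (hX n).aemeasurable
    exact Complex.continuous_re.comp continuous_charFun
  have hsum : ∀ N, ∑ n ∈ Finset.range N, P.real {ω | |X n ω| ≤ R} ≤
      (∫ ξ in (0 : ℝ)..δ, 2 / c * ξ ^ (-α)) * (4 / δ) := by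
    intro N
    have h1 : ∀ n, P.real {ω | |X n ω| ≤ R} ≤
        (∫ ξ in (0 : ℝ)..δ, (1 - ξ / δ) * (charFun (P.map (X n)) ξ).re) * (4 / δ) := fun n => by
      have h2 := measureReal_abs_le_mul_le (P := P) (hX n) hδ
      have h3 : P.real {ω | |X n ω| ≤ R} ≤ P.real {ω | |X n ω| ≤ 1 / δ} :=
        measureReal_mono fun ω (hω : |X n ω| ≤ R) => hω.trans hRδ
      calc _ ≤ P.real {ω | |X n ω| ≤ 1 / δ} := h3
        _ = P.real {ω | |X n ω| ≤ 1 / δ} * (δ / 4) * (4 / δ) := by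
          rw [mul_assoc, show δ / 4 * (4 / δ) = 1 by field_simp, mul_one]
        _ ≤ _ := by gcongr
    refine (Finset.sum_le_sum fun n _ => h1 n).trans ?_
    rw [← Finset.sum_mul, ← intervalIntegral.integral_finsetSum]
    swap
    · intro n _
      have := hcont n
      exact Continuous.intervalIntegrable (by fun_prop) _ _
    refine mul_le_mul_of_nonneg_right ?_ (by positivity)
    refine intervalIntegral.integral_mono_on_of_le_Ioo hδ.le ?_ ?_ ?_
    · refine Continuous.intervalIntegrable ?_ _ _
      exact continuous_finsetSum _ fun n _ => by
        have := hcont n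
        fun_prop
    · exact (intervalIntegral.intervalIntegrable_rpow' (by linarith)).const_mul _
    · intro ξ hξ
      rw [← Finset.mul_sum]
      have h4 : 0 ≤ 2 / c * ξ ^ (-α) :=
        mul_nonneg (by positivity) (Real.rpow_nonneg hξ.1.le _)
      have h5 : 0 ≤ 1 - ξ / δ := by
        have := (div_le_one hδ).2 hξ.2.le
        linarith
      have h6 : 1 - ξ / δ ≤ 1 := by
        have := div_pos hξ.1 hδ
        linarith
      calc _ ≤ (1 - ξ / δ) * (2 / c * ξ ^ (-α)) :=
            mul_le_mul_of_nonneg_left (hgeom N ξ hξ.1 (hξ.2.le.trans hδ1)) h5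
        _ ≤ _ := mul_le_of_le_one_left h4 h6
  exact summable_of_sum_range_le (fun n => measureReal_nonneg) hsum

end

/-! ### The weights: growth of the exponent at zero and the cubic condition -/

section weights

variable {α β : ℝ}

lemma multiWeight_nonneg {p₀ : ℝ} (hp : 0 ≤ p₀) (n : ℤ) : 0 ≤ multiWeight α β p₀ n := by
  unfold multiWeight
  split_ifs <;> positivity

lemma multiWeight_pos {p₀ : ℝ} {n : ℤ} (hn : n ≠ 0) : 0 < multiWeight α β p₀ n := by
  have : (0 : ℝ) < |(n : ℝ)| := by positivity
  unfold multiWeight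
  rw [if_neg hn]
  split_ifs <;> positivity

lemma summable_multiWeight (hα : 0 < α) (hβ : 0 < β) {p₀ : ℝ} (hp : 0 ≤ p₀) :
    Summable (multiWeight α β p₀) := by
  have h0 : Summable fun n : ℤ => if n = 0 then p₀ else 0 :=
    summable_of_ne_finset_zero (s := {0}) fun n hn => by simp_all
  have h1 := Real.summable_abs_int_rpow (b := α + 1) (by linarith)
  have h2 := Real.summable_abs_int_rpow (b := β + 1) (by linarith)
  refine Summable.of_nonneg_of_le (multiWeight_nonneg hp) (fun n => ?_) ((h0.add h1).add h2)
  have e1 : (0 : ℝ) ≤ |(n : ℝ)| ^ (-(α + 1)) := by positivity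
  have e2 : (0 : ℝ) ≤ |(n : ℝ)| ^ (-(β + 1)) := by positivity
  rw [show -(α + 1) = -α - 1 by ring] at *
  rw [show -(β + 1) = -β - 1 by ring] at *
  unfold multiWeight
  split_ifs <;> linarith

lemma tsum_multiWeight_pos (hα : 0 < α) (hβ : 0 < β) {p₀ : ℝ} (hp : 0 ≤ p₀) :
    0 < ∑' n, multiWeight α β p₀ n :=
  (summable_multiWeight hα hβ hp).tsum_pos (multiWeight_nonneg hp) 1 (multiWeight_pos one_ne_zero)

lemma pow_three_div_three_le_sum_sq (N : ℕ) :
    (N : ℝ) ^ 3 / 3 ≤ ∑ k ∈ Finset.Icc 1 N, (k : ℝ) ^ 2 := by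
  induction N with
  | zero => simp
  | succ N ih =>
    rw [Finset.sum_Icc_succ_top (by omega)]
    push_cast
    nlinarith [(Nat.cast_nonneg N : (0 : ℝ) ≤ N)]

/-- The even integers `2, 4, …, 2N`. -/
def evenInts (N : ℕ) : Finset ℤ := (Finset.Icc 1 N).image fun k : ℕ => 2 * (k : ℤ)

/-- The even weights alone make the characteristic exponent at least of order `ξ ^ α` at `0`. -/
lemma exists_le_sum_multiWeight_mul_one_sub_cos (hα : 0 < α) : ∃ c > 0, ∀ p₀ ξ : ℝ, 0 < ξ → ξ ≤ 1 →
    ∃ s : Finset ℤ,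
      c * ξ ^ α ≤ ∑ n ∈ s, multiWeight α β p₀ n * (1 - Real.cos (ξ * n)) := by
  -- For `k ≤ 1 / ξ` the angle `2 k ξ` is below `π`, so `1 - cos` is at least `(8 / π ^ 2) ξ ^ 2 k ^
  -- 2`, and the weight at `2 k` is at least `(2 / ξ) ^ (-α - 1)`. The sum of `k ^ 2` is at least `1
  -- / (24 ξ ^ 3)`, with `24 = 3 * 2 ^ 3`. The powers of `ξ` combine to `(α + 1) + 2 - 3 = α`.
  refine ⟨(2 : ℝ) ^ (-α - 1) * (8 / Real.pi ^ 2) / 24, by positivity, fun p₀ ξ h0 h1 => ?_⟩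
  set N := ⌊1 / ξ⌋₊ with hN
  have hN1 : (N : ℝ) ≤ 1 / ξ := Nat.floor_le (by positivity)
  -- As `ξ ≤ 1`, `N ≥ 1`, so taking the floor loses at most a factor `2`.
  have hN2 : 1 / (2 * ξ) ≤ N := by
    have h2 := Nat.lt_floor_add_one (1 / ξ)
    have h3 : (1 : ℝ) ≤ N := by
      exact_mod_cast (Nat.one_le_floor_iff _).2 (by rw [le_div_iff₀ h0]; linarith)
    have h4 : 1 / (2 * ξ) = 1 / ξ / 2 := by field_simp
    rw [← hN] at h2
    linarith
  refine ⟨evenInts N, ?_⟩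
  have hinj : Set.InjOn (fun k : ℕ => 2 * (k : ℤ)) (Finset.Icc 1 N) := fun a _ b _ h => by
    simpa using h
  rw [evenInts, Finset.sum_image hinj]
  have hterm : ∀ k ∈ Finset.Icc 1 N,
      (2 / ξ) ^ (-α - 1) * (8 / Real.pi ^ 2 * ξ ^ 2) * (k : ℝ) ^ 2 ≤
        multiWeight α β p₀ (2 * (k : ℤ)) * (1 - Real.cos (ξ * (2 * (k : ℤ) : ℤ))) := by
    intro k hk
    rw [Finset.mem_Icc] at hk
    have hk0 : (0 : ℝ) < k := by exact_mod_cast hk.1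
    have hk1 : (k : ℝ) ≤ 1 / ξ := le_trans (by exact_mod_cast hk.2) hN1
    have hw : multiWeight α β p₀ (2 * (k : ℤ)) = (2 * k : ℝ) ^ (-α - 1) := by
      unfold multiWeight
      rw [if_neg (by omega), if_pos (even_two_mul _)]
      push_cast
      rw [abs_of_pos (by positivity)]
    have hcos : 8 / Real.pi ^ 2 * ξ ^ 2 * (k : ℝ) ^ 2 ≤
        1 - Real.cos (ξ * (2 * (k : ℤ) : ℤ)) := by
      push_cast
      have hle : |ξ * (2 * k)| ≤ Real.pi := by
        rw [abs_of_pos (by positivity)]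
        rw [le_div_iff₀ h0] at hk1
        linarith [Real.pi_gt_three]
      have := Real.cos_le_one_sub_mul_cos_sq hle
      calc _ = 2 / Real.pi ^ 2 * (ξ * (2 * k)) ^ 2 := by ring
        _ ≤ _ := by linarith
    rw [hw, mul_assoc]
    refine mul_le_mul ?_ hcos (by positivity) (by positivity)
    refine Real.rpow_le_rpow_of_nonpos (by positivity) ?_ (by linarith)
    calc (2 * k : ℝ) ≤ 2 * (1 / ξ) := by gcongr
      _ = 2 / ξ := by ring
  refine le_trans ?_ (Finset.sum_le_sum hterm)
  rw [← Finset.mul_sum]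
  have hcube : 1 / (24 * ξ ^ 3) ≤ ∑ k ∈ Finset.Icc 1 N, (k : ℝ) ^ 2 := by
    refine le_trans ?_ (pow_three_div_three_le_sum_sq N)
    calc 1 / (24 * ξ ^ 3) = (1 / (2 * ξ)) ^ 3 / 3 := by field_simp; norm_num
      _ ≤ _ := by gcongr
  calc _ = (2 / ξ) ^ (-α - 1) * (8 / Real.pi ^ 2 * ξ ^ 2) * (1 / (24 * ξ ^ 3)) := by
        have e : (2 / ξ) ^ (-α - 1) = 2 ^ (-α - 1) * (ξ ^ α * ξ) := by
          rw [Real.div_rpow (by norm_num) h0.le, div_eq_mul_inv, ← Real.rpow_neg h0.le,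
            show -(-α - 1) = α + 1 by ring, Real.rpow_add_one h0.ne']
        rw [e]
        field_simp
    _ ≤ _ := by gcongr

/-- The integrand is nonnegative, so all mass outside the chosen atoms may be dropped. It serves
both the Lévy measure and the jump law. -/
lemma sum_measureReal_singleton_mul_le_integral (μ : Measure ℝ) [IsFiniteMeasure μ]
    (s : Finset ℤ) (ξ : ℝ) :
    ∑ n ∈ s, μ.real {(n : ℝ)} * (1 - Real.cos (ξ * n)) ≤ ∫ y, (1 - Real.cos (ξ * y)) ∂μ := by
  have hint : Integrable (fun y => 1 - Real.cos (ξ * y)) μ := by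
    refine Integrable.of_bound (by fun_prop) 2 (ae_of_all _ fun y => ?_)
    rw [Real.norm_eq_abs, abs_le]
    constructor <;> linarith [Real.cos_le_one (ξ * y), Real.neg_one_le_cos (ξ * y)]
  have h1 := setIntegral_finset (s.image fun n : ℤ => (n : ℝ))
    hint.integrableOn
  rw [Finset.sum_image (fun a _ b _ h => by simpa using h)] at h1
  simp only [smul_eq_mul] at h1
  rw [← h1]
  exact setIntegral_le_integral hint (ae_of_all _ fun y => by
    simp only [Pi.zero_apply]; linarith [Real.cos_le_one (ξ * y)])

lemma multiLevyMeasure_singleton (n : ℤ) :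
    multiLevyMeasure α β {(n : ℝ)} = ENNReal.ofReal (multiWeight α β 0 n) := by
  rw [multiLevyMeasure, Measure.sum_apply _ (measurableSet_singleton _), tsum_eq_single n]
  · simp
  · intro m hm
    simp [hm]

lemma multiLevyMeasure_real_singleton (n : ℤ) :
    (multiLevyMeasure α β).real {(n : ℝ)} = multiWeight α β 0 n := by
  rw [measureReal_def, multiLevyMeasure_singleton,
    ENNReal.toReal_ofReal (multiWeight_nonneg le_rfl n)]

lemma isFiniteMeasure_multiLevyMeasure (hα : 0 < α) (hβ : 0 < β) :
    IsFiniteMeasure (multiLevyMeasure α β) := by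
  refine ⟨?_⟩
  rw [multiLevyMeasure, Measure.sum_apply _ MeasurableSet.univ]
  simp only [Measure.smul_apply, measure_univ, smul_eq_mul, mul_one]
  rw [← ENNReal.ofReal_tsum_of_nonneg (multiWeight_nonneg le_rfl)
    (summable_multiWeight hα hβ le_rfl)]
  exact ENNReal.ofReal_lt_top

lemma exists_le_integral_one_sub_cos (hα : 0 < α) (hβ : 0 < β) : ∃ c > 0, ∀ ξ : ℝ, 0 < ξ → ξ ≤ 1 →
    c * ξ ^ α ≤ ∫ y, (1 - Real.cos (ξ * y)) ∂(multiLevyMeasure α β) := by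
  obtain ⟨c, hc, h⟩ := exists_le_sum_multiWeight_mul_one_sub_cos (β := β) hα
  have := isFiniteMeasure_multiLevyMeasure hα hβ
  refine ⟨c, hc, fun ξ h0 h1 => ?_⟩
  obtain ⟨s, hs⟩ := h 0 ξ h0 h1
  refine hs.trans ?_
  simpa only [multiLevyMeasure_real_singleton] using
    sum_measureReal_singleton_mul_le_integral (multiLevyMeasure α β) s ξ

/-- The cubic condition for the weights. -/
lemma cubicCondition_multiWeight_iff (hα1 : α < 1) (p₀ : ℝ) :
    CubicCondition (multiWeight α β p₀) ↔ β < 1 := by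
  have hval : ∀ n : ℕ, 1 / (((n : ℝ) + 1) ^ 3 * multiWeight α β p₀ ((n : ℤ) + 1)) =
      if Even (n + 1) then ((n + 1 : ℕ) : ℝ) ^ (α - 2) else ((n + 1 : ℕ) : ℝ) ^ (β - 2) := by
    intro n
    have hpos : (0 : ℝ) < (n : ℝ) + 1 := by positivity
    have key : ∀ γ : ℝ, 1 / (((n : ℝ) + 1) ^ 3 * ((n : ℝ) + 1) ^ (-γ - 1)) =
        ((n : ℝ) + 1) ^ (γ - 2) := fun γ => by
      rw [← Real.rpow_natCast, ← Real.rpow_add hpos, one_div, ← Real.rpow_neg hpos.le]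
      congr 1
      push_cast
      ring
    have hev : Even ((n : ℤ) + 1) ↔ Even (n + 1) := by
      exact_mod_cast Int.even_coe_nat (n + 1)
    unfold multiWeight
    rw [if_neg (by omega)]
    simp only [hev]
    push_cast
    rw [abs_of_pos hpos]
    split_ifs
    · exact key α
    · exact key β
  unfold CubicCondition
  simp only [hval]
  constructor
  · intro h
    by_contra! hβ
    -- The index is shifted by one, so `n = 2 * j` selects the odd integer `2 * j + 1`. For `β ≥ 1`
    -- its term is at least `1 / (2 * j + 1)`, and the harmonic series diverges.
    have hinj : Function.Injective fun j : ℕ => 2 * j := fun a b h => by simpa using h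
    have h1 := h.comp_injective hinj
    have h2 : Summable fun j : ℕ => (1 / 2 : ℝ) * (1 / ((j + 1 : ℕ) : ℝ)) := by
      refine Summable.of_nonneg_of_le (fun j => by positivity) (fun j => ?_) h1
      simp only [Function.comp_apply]
      rw [if_neg (by simp)]
      have hge : (1 : ℝ) ≤ ((2 * j + 1 : ℕ) : ℝ) := by norm_cast; omega
      calc (1 / 2 : ℝ) * (1 / ((j + 1 : ℕ) : ℝ)) = ((2 * (j + 1) : ℕ) : ℝ) ⁻¹ := by
            push_cast; field_simp
        _ ≤ ((2 * j + 1 : ℕ) : ℝ)⁻¹ := by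
            refine inv_anti₀ (by positivity) ?_
            exact_mod_cast (by omega)
        _ = ((2 * j + 1 : ℕ) : ℝ) ^ (-1 : ℝ) := (Real.rpow_neg_one _).symm
        _ ≤ _ := Real.rpow_le_rpow_of_exponent_le hge (by linarith)
    rw [summable_mul_left_iff (by norm_num)] at h2
    exact Real.not_summable_one_div_natCast
      ((summable_nat_add_iff (f := fun n : ℕ => 1 / (n : ℝ)) 1).1 h2)
  · intro hβ
    have hs : ∀ γ : ℝ, γ < 1 → Summable fun n : ℕ => ((n + 1 : ℕ) : ℝ) ^ (γ - 2) := fun γ hγ =>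
      (summable_nat_add_iff (f := fun n : ℕ => (n : ℝ) ^ (γ - 2)) 1).2
        (Real.summable_nat_rpow.2 (by linarith))
    refine Summable.of_nonneg_of_le (fun n => ?_) (fun n => ?_) ((hs α hα1).add (hs β hβ))
    · split_ifs <;> positivity
    · have e1 : (0 : ℝ) ≤ ((n + 1 : ℕ) : ℝ) ^ (α - 2) := by positivity
      have e2 : (0 : ℝ) ≤ ((n + 1 : ℕ) : ℝ) ^ (β - 2) := by positivity
      split_ifs <;> linarith

lemma cubicCondition_const_mul_iff {c : ℝ} (hc : c ≠ 0) (q : ℤ → ℝ) :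
    CubicCondition (fun n => c * q n) ↔ CubicCondition q := by
  unfold CubicCondition
  rw [← summable_mul_left_iff (a := c⁻¹) (f := fun n : ℕ => 1 / (((n : ℝ) + 1) ^ 3 * q ((n : ℤ) + 1)))
    (inv_ne_zero hc)]
  refine summable_congr fun n => ?_
  simp only [one_div, mul_inv]
  ring

end weights

/-! ### Borel–Cantelli -/

lemma ae_eventually_notMem_of_summable_measureReal {Ω : Type*} [MeasurableSpace Ω] {P : Measure Ω}
    [IsFiniteMeasure P] {s : ℕ → Set Ω} (h : Summable fun n => P.real (s n)) :
    ∀ᵐ ω ∂P, ∀ᶠ n in atTop, ω ∉ s n := by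
  refine ae_eventually_notMem ?_
  have h1 : ∀ n, P (s n) = ENNReal.ofReal (P.real (s n)) := fun n => (ofReal_measureReal).symm
  simp only [h1]
  exact h.tsum_ofReal_ne_top

lemma isTransient_of_summable {Ω : Type*} [MeasurableSpace Ω] {P : Measure Ω}
    [IsFiniteMeasure P] {X : ℕ → Ω → ℝ}
    (h : ∀ R : ℝ, Summable fun n => P.real {ω | |X n ω| ≤ R}) : IsTransient X P := by
  have h1 : ∀ R : ℕ, ∀ᵐ ω ∂P, ∀ᶠ n in atTop, ω ∉ {ω | |X n ω| ≤ (R : ℝ)} := fun R =>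
    ae_eventually_notMem_of_summable_measureReal (h R)
  filter_upwards [ae_all_iff.2 h1] with ω hω
  refine tendsto_atTop.2 fun b => ?_
  obtain ⟨R, hR⟩ := exists_nat_ge b
  filter_upwards [hω R] with n hn
  exact hR.trans (not_le.1 hn).le

/-! ### The random walk -/

section walk

variable {Ω : Type*} [MeasurableSpace Ω] {P : Measure Ω}
  {J : ℕ → Ω → ℤ}

lemma measurable_randomWalk (hJ : AreJumps J P) (n : ℕ) :
    Measurable fun ω => (randomWalk J n ω : ℝ) := by
  have := hJ.measurable
  unfold randomWalk
  push_cast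
  fun_prop

lemma charFun_randomWalk [IsProbabilityMeasure P] (hJ : AreJumps J P) (n : ℕ) (ξ : ℝ) :
    charFun (P.map fun ω => (randomWalk J n ω : ℝ)) ξ =
      charFun (P.map fun ω => (J 0 ω : ℝ)) ξ ^ n := by
  have hm : ∀ i, Measurable fun ω => (J i ω : ℝ) := fun i => by
    have := hJ.measurable i
    fun_prop
  have hind : iIndepFun (fun i ω => (J i ω : ℝ)) P :=
    hJ.indep.comp (fun _ (k : ℤ) => (k : ℝ)) fun _ => by fun_prop
  have h := iIndepFun.charFun_map_fun_finsetSum_eq_prod (s := Finset.range n)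
    (fun i _ => (hm i).aemeasurable) (hind.restrict _)
  have hlaw : ∀ i, P.map (fun ω => (J i ω : ℝ)) = P.map fun ω => (J 0 ω : ℝ) := fun i =>
    ((hJ.identDistrib i).comp (u := fun k : ℤ => (k : ℝ)) (by fun_prop)).map_eq
  simp only [hlaw, Finset.prod_const, Finset.card_range] at h
  have h2 := congrFun h ξ
  simpa [randomWalk] using h2

lemma summable_randomWalk [IsProbabilityMeasure P]
    {α β p₀ : ℝ} (hα : 0 < α) (hα1 : α < 1) (hβ : 0 < β) (hp : 0 ≤ p₀)
    (hJ : AreJumps J P)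
    (hlaw : ∀ n : ℤ, P.real {ω | J 0 ω = n} =
        (∑' m : ℤ, multiWeight α β p₀ m)⁻¹ * multiWeight α β p₀ n) (R : ℝ) :
    Summable fun n => P.real {ω | |(randomWalk J n ω : ℝ)| ≤ R} := by
  obtain ⟨c, hc, hle⟩ := exists_le_sum_multiWeight_mul_one_sub_cos (β := β) hα
  set C := ∑' m : ℤ, multiWeight α β p₀ m
  have hC : 0 < C := tsum_multiWeight_pos hα hβ hp
  have hm0 : Measurable fun ω => (J 0 ω : ℝ) := by
    have := hJ.measurable 0
    fun_prop
  have := Measure.isProbabilityMeasure_map (μ := P) hm0.aemeasurable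
  refine summable_measureReal_abs_le (measurable_randomWalk hJ) (charFun_randomWalk hJ)
    (c := C⁻¹ * c) (by positivity) hα1 (fun ξ h0 h1 => ?_) R
  obtain ⟨s, hs⟩ := hle p₀ ξ h0 h1
  have h2 := sum_measureReal_singleton_mul_le_integral (P.map fun ω => (J 0 ω : ℝ)) s ξ
  have h3 : ∀ n : ℤ, (P.map fun ω => (J 0 ω : ℝ)).real {(n : ℝ)} = C⁻¹ * multiWeight α β p₀ n := by
    intro n
    rw [map_measureReal_apply hm0 (measurableSet_singleton _), ← hlaw n]
    congr 1
    ext ω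
    simp
  rw [re_charFun_map hm0]
  have h4 : ∫ y, (1 - Real.cos (ξ * y)) ∂(P.map fun ω => (J 0 ω : ℝ)) =
      1 - ∫ ω, Real.cos (ξ * J 0 ω) ∂P := by
    rw [integral_map hm0.aemeasurable (by fun_prop), integral_sub (integrable_const _)]
    · simp
    · exact Integrable.of_bound (Measurable.aestronglyMeasurable (by fun_prop)) 1 (ae_of_all _ fun ω => by
        simpa using Real.abs_cos_le_one _)
  rw [← h4]
  refine le_trans ?_ h2
  simp only [h3, mul_assoc, ← Finset.mul_sum]
  gcongr

/-- A return to `u` means that the walk from `0` is at `0`, which is the interval of radius `0`. -/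
lemma isTransientChain_of_summable
    (h : Summable fun n => P.real {ω | |(randomWalk J n ω : ℝ)| ≤ 0}) :
    IsTransientChain J P := by
  intro u
  have h1 := (summable_nat_add_iff 1).2 h
  refine h1.congr fun n => ?_
  congr 1
  ext ω
  simp

end walk

/-! ### Maximal inequalities -/

section

variable {Ω : Type*} [MeasurableSpace Ω] {P : Measure Ω} [IsProbabilityMeasure P]

/-- A first-passage inequality of Ottaviani type: if the remaining increments stay within `K` with
probability at least `1 / 2`, then a visit of `[-R, R]` between the times `a` and `M` is at most
twice as likely as being in `[-(R + K), R + K]` at time `M`. -/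
lemma measureReal_exists_abs_sum_le {D : ℕ → Ω → ℝ} (hD : ∀ i, Measurable (D i))
    (hind : iIndepFun D P) {a M : ℕ} {R K : ℝ}
    (hK : ∀ k ∈ Finset.Icc a M, 1 / 2 ≤ P.real {ω | |∑ i ∈ Finset.Ico k M, D i ω| ≤ K}) :
    P.real {ω | ∃ k ∈ Finset.Icc a M, |∑ i ∈ Finset.range k, D i ω| ≤ R} ≤
      2 * P.real {ω | |∑ i ∈ Finset.range M, D i ω| ≤ R + K} := by
  set S : ℕ → Ω → ℝ := fun k ω => ∑ i ∈ Finset.range k, D i ω with hS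
  -- `B k` says that `k` is the first visit at or after time `a`, and depends only on `D i` with `i
  -- < k`; `G k` depends only on `D i` with `i ≥ k`. Independence gives `P (B k) ≤ 2 P (B k ∩ G k)`.
  -- These intersections are disjoint, and on each the sum at time `M` is at most `R + K` in
  -- absolute value.
  set B : ℕ → Set Ω := fun k => {ω | |S k ω| ≤ R ∧ ∀ j ∈ Finset.Ico a k, R < |S j ω|} with hB
  set G : ℕ → Set Ω := fun k => {ω | |∑ i ∈ Finset.Ico k M, D i ω| ≤ K} with hG
  let m : ℕ → MeasurableSpace Ω := fun i => MeasurableSpace.comap (D i) inferInstance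
  have hm : ∀ i, m i ≤ ‹MeasurableSpace Ω› := fun i => (hD i).comap_le
  have hmeasD : ∀ (I : Set ℕ), ∀ i ∈ I, Measurable[⨆ i ∈ I, m i] (D i) := fun I i hi =>
    Measurable.mono (comap_measurable (D i)) (le_iSup₂ (f := fun i (_ : i ∈ I) => m i) i hi) le_rfl
  have hsub : ∀ k, ∀ j ≤ k, Measurable[⨆ i ∈ Set.Iio k, m i] (S j) := fun k j hj =>
    Finset.measurable_fun_sum _ fun i hi => hmeasD _ i (by
      simp only [Finset.mem_range] at hi; simp only [Set.mem_Iio]; omega)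
  have hBm : ∀ k, MeasurableSet[⨆ i ∈ Set.Iio k, m i] (B k) := by
    intro k
    have h1 : ∀ j ≤ k, Measurable[⨆ i ∈ Set.Iio k, m i] fun ω => |S j ω| := fun j hj =>
      (continuous_abs.measurable).comp (hsub k j hj)
    have h2 : B k = (fun ω => |S k ω|) ⁻¹' Set.Iic R ∩
        ⋂ j ∈ Finset.Ico a k, (fun ω => |S j ω|) ⁻¹' Set.Ioi R := by
      ext ω; simp [hB]
    rw [h2]
    refine @MeasurableSet.inter _ (⨆ i ∈ Set.Iio k, m i) _ _ (h1 k le_rfl measurableSet_Iic) ?_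
    exact @Finset.measurableSet_biInter _ _ (⨆ i ∈ Set.Iio k, m i) _ _ fun j hj =>
      h1 j (Finset.mem_Ico.1 hj).2.le measurableSet_Ioi
  have hGm : ∀ k, MeasurableSet[⨆ i ∈ Set.Ici k, m i] (G k) := by
    intro k
    have h1 : Measurable[⨆ i ∈ Set.Ici k, m i] fun ω => ∑ i ∈ Finset.Ico k M, D i ω :=
      Finset.measurable_fun_sum _ fun i hi => hmeasD _ i (Finset.mem_Ico.1 hi).1
    exact (continuous_abs.measurable).comp h1 measurableSet_Iic
  have hBG : ∀ k ∈ Finset.Icc a M, P.real (B k) ≤ 2 * P.real (B k ∩ G k) := by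
    intro k hk
    have hI := indep_iSup_of_disjoint hm (hind : iIndep m P)
      (S := Set.Iio k) (T := Set.Ici k) (by
        rw [Set.disjoint_left]; intro x hx hx'
        exact absurd (Set.mem_Iio.1 hx) (not_lt.2 hx'))
    have h1 := (Indep_iff _ _ _).1 hI _ _ (hBm k) (hGm k)
    have h2 : P.real (B k ∩ G k) = P.real (B k) * P.real (G k) := by
      simp only [measureReal_def, h1, ENNReal.toReal_mul]
    rw [h2]
    nlinarith [hK k hk, measureReal_nonneg (μ := P) (s := B k)]
  have hBm' : ∀ k, MeasurableSet (B k) := fun k => iSup₂_le (fun i _ => hm i) _ (hBm k)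
  have hGm' : ∀ k, MeasurableSet (G k) := fun k => iSup₂_le (fun i _ => hm i) _ (hGm k)
  have hcover : {ω | ∃ k ∈ Finset.Icc a M, |S k ω| ≤ R} ⊆ ⋃ k ∈ Finset.Icc a M, B k := by
    intro ω hω
    classical
    have hω' : ∃ k, k ∈ Finset.Icc a M ∧ |S k ω| ≤ R := hω
    simp only [Set.mem_iUnion]
    refine ⟨Nat.find hω', (Nat.find_spec hω').1, (Nat.find_spec hω').2, fun j hj => ?_⟩
    rw [Finset.mem_Ico] at hj
    have h1 := Nat.find_min hω' hj.2
    have h2 := (Finset.mem_Icc.1 (Nat.find_spec hω').1).2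
    by_contra! h3
    exact h1 ⟨Finset.mem_Icc.2 ⟨hj.1, hj.2.le.trans h2⟩, h3⟩
  have hdisj : Set.PairwiseDisjoint (↑(Finset.Icc a M)) fun k => B k ∩ G k := by
    have key : ∀ j k, a ≤ j → j < k → Disjoint (B j ∩ G j) (B k ∩ G k) := by
      intro j k haj hjk
      rw [Set.disjoint_left]
      rintro ω ⟨h1, -⟩ ⟨h2, -⟩
      exact absurd h1.1 (not_le.2 (h2.2 j (Finset.mem_Ico.2 ⟨haj, hjk⟩)))
    intro j hj k hk hjk
    simp only [Finset.coe_Icc, Set.mem_Icc] at hj hk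
    rcases lt_or_gt_of_ne hjk with h | h
    · exact key j k hj.1 h
    · exact (key k j hk.1 h).symm
  calc P.real {ω | ∃ k ∈ Finset.Icc a M, |S k ω| ≤ R}
      ≤ P.real (⋃ k ∈ Finset.Icc a M, B k) := measureReal_mono hcover (measure_ne_top _ _)
    _ ≤ ∑ k ∈ Finset.Icc a M, P.real (B k) := measureReal_biUnion_finset_le _ _
    _ ≤ ∑ k ∈ Finset.Icc a M, 2 * P.real (B k ∩ G k) := Finset.sum_le_sum hBG
    _ = 2 * P.real (⋃ k ∈ Finset.Icc a M, B k ∩ G k) := by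
        rw [← Finset.mul_sum, measureReal_biUnion_finset hdisj fun k _ => (hBm' k).inter (hGm' k)]
    _ ≤ _ := by
        refine mul_le_mul_of_nonneg_left (measureReal_mono ?_) two_pos.le
        refine Set.iUnion₂_subset fun k hk => ?_
        rintro ω ⟨h1, h2⟩
        simp only [Set.mem_ofPred_eq]
        rw [← Finset.sum_range_add_sum_Ico _ (Finset.mem_Icc.1 hk).2]
        exact (abs_add_le _ _).trans (add_le_add h1.1 h2)

lemma exists_measureReal_lt_abs_le {X : Ω → ℝ} (hX : Measurable X) {ε : ℝ} (hε : 0 < ε) :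
    ∃ K : ℝ, P.real {ω | K < |X ω|} ≤ ε := by
  have h : Tendsto (fun n : ℕ => P.real {ω | (n : ℝ) < |X ω|}) atTop (𝓝 0) := by
    have h1 : Tendsto (fun n : ℕ => P {ω | (n : ℝ) < |X ω|}) atTop
        (𝓝 (P (⋂ n : ℕ, {ω | (n : ℝ) < |X ω|}))) := by
      refine tendsto_measure_iInter_atTop
        (fun n => (measurableSet_lt (by fun_prop) (by fun_prop)).nullMeasurableSet) ?_
        ⟨0, measure_ne_top _ _⟩
      intro i j hij ω (hω : (j : ℝ) < |X ω|)
      exact lt_of_le_of_lt (by exact_mod_cast hij) hω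
    have h2 : (⋂ n : ℕ, {ω | (n : ℝ) < |X ω|}) = ∅ := by
      refine Set.eq_empty_of_forall_notMem fun ω hω => ?_
      obtain ⟨n, hn⟩ := exists_nat_ge |X ω|
      exact absurd (Set.mem_iInter.1 hω n) (not_lt.2 hn)
    rw [h2, measure_empty] at h1
    simpa [measureReal_def, Function.comp_def] using (ENNReal.tendsto_toReal ENNReal.zero_ne_top).comp h1
  obtain ⟨n, hn⟩ := (h.eventually_le_const hε).exists
  exact ⟨n, hn⟩

/-- Lévy's inequality for a sum of two independent variables, the second one symmetric. -/
lemma measureReal_lt_abs_le_two_mul {X Y : Ω → ℝ} (hX : Measurable X) (hY : Measurable Y)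
    (hXY : IndepFun X Y P) (hsymm : P.map Y = P.map (fun ω => -Y ω)) (K : ℝ) :
    P.real {ω | K < |X ω|} ≤ 2 * P.real {ω | K < |X ω + Y ω|} := by
  have hYid : IdentDistrib Y (fun ω => -Y ω) P P :=
    ⟨hY.aemeasurable, hY.neg.aemeasurable, hsymm⟩
  have hXid : IdentDistrib X X P P := IdentDistrib.refl hX.aemeasurable
  -- By independence `(X, Y)` and `(X, -Y)` have the same law. As `2 X = (X + Y) + (X - Y)`, `|X| >
  -- K` forces one of `|X + Y|`, `|X - Y|` to exceed `K`.
  have hpair := hXid.prodMk hYid hXY (hXY.comp measurable_id measurable_neg)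
  have hms : MeasurableSet {p : ℝ × ℝ | K < |p.1 + p.2|} :=
    measurableSet_lt (by fun_prop) (by fun_prop)
  have h1 : P.real {ω | K < |X ω + Y ω|} = P.real {ω | K < |X ω + -Y ω|} := by
    have := hpair.measure_mem_eq hms
    rw [measureReal_def, measureReal_def]
    exact congrArg _ this
  have h2 : {ω | K < |X ω|} ⊆ {ω | K < |X ω + Y ω|} ∪ {ω | K < |X ω + -Y ω|} := by
    intro ω (hω : K < |X ω|)
    by_contra! h
    simp only [Set.mem_union, Set.mem_ofPred_eq, not_or, not_lt] at h
    have h3 := abs_add_le (X ω + Y ω) (X ω + -Y ω)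
    rw [show X ω + Y ω + (X ω + -Y ω) = 2 * X ω by ring, abs_mul, abs_two] at h3
    linarith
  calc _ ≤ P.real {ω | K < |X ω + Y ω|} + P.real {ω | K < |X ω + -Y ω|} :=
        (measureReal_mono h2).trans (measureReal_union_le _ _)
    _ = _ := by rw [← h1]; ring

end

/-! ### The Lévy process: integer skeleton and passage to continuous time -/

section

variable {Ω : Type*} [MeasurableSpace Ω] {P : Measure Ω} {L : ℝ≥0 → Ω → ℝ} {α β : ℝ}

/-- The drift and the compensator are purely imaginary. Since the measure is finite, the bounded
integrand is integrable and real parts pass inside. -/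
lemma re_levyExponent_multiLevyMeasure (hα : 0 < α) (hβ : 0 < β) (b c ξ : ℝ) :
    (levyExponent b c (multiLevyMeasure α β) ξ).re =
      c * ξ ^ 2 / 2 + ∫ y, (1 - Real.cos (ξ * y)) ∂(multiLevyMeasure α β) := by
  have := isFiniteMeasure_multiLevyMeasure hα hβ
  have hmeas : Measurable fun y : ℝ => (if |y| ≤ 1 then y else 0 : ℝ) :=
    Measurable.ite (measurableSet_le (by fun_prop) (by fun_prop)) measurable_id measurable_const
  have hi : Integrable (fun y : ℝ => (1 - Complex.exp (Complex.I * ξ * y) +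
      Complex.I * ξ * ((if |y| ≤ 1 then y else 0 : ℝ) : ℂ))) (multiLevyMeasure α β) := by
    refine Integrable.of_bound (Measurable.aestronglyMeasurable (by fun_prop)) (2 + |ξ|)
      (ae_of_all _ fun y => ?_)
    have h1 : ‖Complex.exp (Complex.I * ξ * y)‖ = 1 := by
      rw [show Complex.I * ξ * y = ((ξ * y : ℝ) : ℂ) * Complex.I by push_cast; ring,
        Complex.norm_exp_ofReal_mul_I]
    have h2 : ‖((if |y| ≤ 1 then y else 0 : ℝ) : ℂ)‖ ≤ 1 := by
      rw [Complex.norm_real, Real.norm_eq_abs]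
      split_ifs with h
      · exact h
      · simp
    have h3 : ‖Complex.I * ξ * ((if |y| ≤ 1 then y else 0 : ℝ) : ℂ)‖ ≤ |ξ| := by
      rw [norm_mul, norm_mul, Complex.norm_I, one_mul, Complex.norm_real, Real.norm_eq_abs]
      exact mul_le_of_le_one_right (abs_nonneg _) h2
    refine (norm_add_le _ _).trans (add_le_add ((norm_sub_le _ _).trans ?_) h3)
    rw [h1, norm_one]
    norm_num
  have h1 := integral_re hi
  simp only [RCLike.re_to_complex] at h1
  rw [levyExponent, Complex.add_re, Complex.add_re, ← h1]
  congr 1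
  · rw [show Complex.I * ξ * b = ((ξ * b : ℝ) : ℂ) * Complex.I by push_cast; ring,
      Complex.re_ofReal_mul, Complex.I_re, mul_zero, zero_add,
      show (c : ℂ) * ξ ^ 2 / 2 = ((c * ξ ^ 2 / 2 : ℝ) : ℂ) by push_cast; ring, Complex.ofReal_re]
  · congr with y
    rw [Complex.add_re, Complex.sub_re, Complex.one_re,
      show Complex.I * ξ * y = ((ξ * y : ℝ) : ℂ) * Complex.I by push_cast; ring,
      Complex.exp_ofReal_mul_I_re, mul_assoc, ← Complex.ofReal_mul, Complex.I_mul_re,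
      Complex.ofReal_im, neg_zero, add_zero]

/-- The time-one skeleton of the process visits bounded intervals finitely often in the mean. -/
lemma summable_measureReal_abs_le_of_hasLevyMeasure [IsProbabilityMeasure P] (hα : 0 < α)
    (hα1 : α < 1) (hβ : 0 < β) (hL : ∀ t, Measurable (L t))
    (hν : HasLevyMeasure L P (multiLevyMeasure α β)) (R : ℝ) :
    Summable fun n : ℕ => P.real {ω | |L n ω| ≤ R} := by
  obtain ⟨b, σ, hT⟩ := hν
  obtain ⟨c, hc, hle⟩ := exists_le_integral_one_sub_cos hα hβ
  refine summable_measureReal_abs_le (X := fun n : ℕ => L n) (fun n => hL n)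
    (z := fun ξ => Complex.exp (-levyExponent b σ (multiLevyMeasure α β) ξ)) (fun n ξ => ?_)
    (c := c / (1 + c)) (by positivity) hα1 (fun ξ h0 h1 => ?_) R
  · rw [charFun_apply_real, integral_map (hL n).aemeasurable (by fun_prop), ← Complex.exp_nat_mul]
    have h2 := hT.charFun_eq n ξ
    simp only [NNReal.coe_natCast, Complex.ofReal_natCast, neg_mul] at h2
    rw [mul_neg, ← h2]
    congr with ω
    congr 1
    ring
  · have h2 : c * ξ ^ α ≤ (levyExponent b σ (multiLevyMeasure α β) ξ).re := by
      rw [re_levyExponent_multiLevyMeasure hα hβ]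
      have h3 : 0 ≤ σ * ξ ^ 2 / 2 := by
        have := hT.nonneg
        positivity
      linarith [hle ξ h0 h1]
    have h3 := Complex.re_le_norm (Complex.exp (-levyExponent b σ (multiLevyMeasure α β) ξ))
    rw [Complex.norm_exp, Complex.neg_re] at h3
    set y := c * ξ ^ α with hy
    have hx : ξ ^ α ≤ 1 := Real.rpow_le_one h0.le h1 hα.le
    have hx0 : 0 < ξ ^ α := Real.rpow_pos_of_pos h0 _
    have hy0 : 0 < y := by positivity
    -- Bounding `exp (-y)` by `1 / (1 + y)` leaves `y / (1 + y)`, and `y ≤ c` because `ξ ≤ 1`; hence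
    -- the constant `c / (1 + c)`.
    have h4 : Real.exp (-(levyExponent b σ (multiLevyMeasure α β) ξ).re) ≤ (1 + y)⁻¹ := by
      refine (Real.exp_le_exp.2 (neg_le_neg h2)).trans ?_
      rw [Real.exp_neg]
      refine inv_anti₀ (by positivity) ?_
      linarith [Real.add_one_le_exp y]
    have h5 : c / (1 + c) * ξ ^ α ≤ 1 - (1 + y)⁻¹ := by
      have e : 1 - (1 + y)⁻¹ = y / (1 + y) := by field_simp; ring
      rw [e, div_mul_eq_mul_div, ← hy]
      have : y ≤ c := by nlinarith
      gcongr
    linarith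

lemma IsSymmetricProcess.map_eq (hL : ∀ t, Measurable (L t)) (hS : IsSymmetricProcess L P)
    (u : ℝ≥0) : P.map (L u) = P.map fun ω => -L u ω := by
  have h := congrArg (Measure.map fun v : ({u} : Finset ℝ≥0) → ℝ => v ⟨u, by simp⟩) (hS {u})
  have h1 : Measurable fun ω => ({u} : Finset ℝ≥0).restrict fun t => L t ω :=
    measurable_pi_lambda _ fun i => hL i
  have h2 : Measurable fun ω => ({u} : Finset ℝ≥0).restrict fun t => -L t ω :=
    measurable_pi_lambda _ fun i => (hL i).neg
  rw [Measure.map_map (by fun_prop) h1, Measure.map_map (by fun_prop) h2] at h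
  exact h

lemma IsLevyProcess.map_increment_eq (hLP : IsLevyProcess L P) {s t : ℝ≥0} (hst : s ≤ t) :
    P.map (fun ω => L t ω - L s ω) = P.map (L (t - s)) := by
  have h1 := (hLP.stationary s (t - s)).map_eq
  rw [add_tsub_cancel_of_le hst] at h1
  rw [h1]
  refine Measure.map_congr ?_
  filter_upwards [hLP.zero] with ω hω
  rw [hω, sub_zero]

/-- Symmetry of the one-dimensional marginals suffices: by stationarity the increment has the law of
`L (t - s)`. -/
lemma IsLevyProcess.map_neg_increment_eq (hLP : IsLevyProcess L P) (hS : IsSymmetricProcess L P)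
    {s t : ℝ≥0} (hst : s ≤ t) :
    P.map (fun ω => L t ω - L s ω) = P.map (fun ω => -(L t ω - L s ω)) := by
  have hm : Measurable fun ω => L t ω - L s ω := (hLP.measurable t).sub (hLP.measurable s)
  have h1 := congrArg (Measure.map fun x : ℝ => -x) (hLP.map_increment_eq hst)
  rw [Measure.map_map measurable_neg hm, Measure.map_map measurable_neg (hLP.measurable _)] at h1
  rw [hLP.map_increment_eq hst, hS.map_eq hLP.measurable]
  exact h1.symm

/-- Stationarity reduces to an increment over `[0, u]` with `u ≤ 1`. The increment over `[u, 1]` is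
independent and symmetric, so Lévy's inequality controls it by the increment over `[0, 1]`. Choosing
`K` with tail `1 / 4` there gives tail at most `1 / 2` for every `u`. -/
lemma IsLevyProcess.exists_half_le_measureReal [IsProbabilityMeasure P] (hLP : IsLevyProcess L P)
    (hS : IsSymmetricProcess L P) :
    ∃ K : ℝ, ∀ s t : ℝ≥0, s ≤ t → t ≤ s + 1 →
      1 / 2 ≤ P.real {ω | |L t ω - L s ω| ≤ K} := by
  have hm : ∀ s t, Measurable fun ω => L t ω - L s ω := fun s t =>
    (hLP.measurable t).sub (hLP.measurable s)
  obtain ⟨K, hK⟩ := exists_measureReal_lt_abs_le (P := P) (hm 0 1) (ε := 1 / 4) (by norm_num)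
  refine ⟨K, fun s t hst hts => ?_⟩
  set u := t - s with hu
  have hu1 : u ≤ 1 := by rw [hu, tsub_le_iff_left]; exact hts
  have hset : MeasurableSet {x : ℝ | K < |x|} := measurableSet_lt (by fun_prop) (by fun_prop)
  have h1 := measureReal_lt_abs_le_two_mul (hm 0 u) (hm u 1)
    (hLP.indep.indepFun_sub_sub zero_le hu1) (hLP.map_neg_increment_eq hS hu1) K
  simp only [sub_add_sub_cancel'] at h1
  have h2 : P.real {ω | K < |L t ω - L s ω|} = P.real {ω | K < |L u ω - L 0 ω|} := by
    have e : P.map (fun ω => L t ω - L s ω) = P.map (fun ω => L u ω - L 0 ω) := by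
      rw [hLP.map_increment_eq hst, hLP.map_increment_eq zero_le, tsub_zero]
    have e1 := map_measureReal_apply (μ := P) (hm s t) hset
    have e2 := map_measureReal_apply (μ := P) (hm 0 u) hset
    rw [e] at e1
    exact e1.symm.trans e2
  have h3 : {ω | |L t ω - L s ω| ≤ K} = {ω | K < |L t ω - L s ω|}ᶜ := by
    ext ω; simp
  have h4 : MeasurableSet {ω | K < |L t ω - L s ω|} := hm s t hset
  rw [h3, probReal_compl_eq_one_sub h4, h2]
  linarith

/-- The dyadic times `k / 2 ^ m`. -/
noncomputable def dyadicTime (m k : ℕ) : ℝ≥0 := k / 2 ^ m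

lemma dyadicTime_mono (m : ℕ) : Monotone (dyadicTime m) := fun a b h => by
  unfold dyadicTime; gcongr

lemma dyadicTime_mul (n m : ℕ) : dyadicTime m (n * 2 ^ m) = n := by
  unfold dyadicTime; push_cast; field_simp

lemma dyadicTime_two_mul (m k : ℕ) : dyadicTime (m + 1) (2 * k) = dyadicTime m k := by
  unfold dyadicTime; push_cast; rw [pow_succ]; field_simp

/-- Once the mesh is below `u - t`, the first grid point strictly after `t` lies before `u`. It may
equal `n + 1`, so the index range includes the right endpoint. -/
lemma exists_dyadicTime_mem_Ioo {t : ℝ≥0} {n : ℕ} (hn : (n : ℝ≥0) ≤ t) (hn1 : t < n + 1)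
    {u : ℝ≥0} (hu : t < u) :
    ∃ m, ∃ k ∈ Finset.Icc (n * 2 ^ m) ((n + 1) * 2 ^ m), dyadicTime m k ∈ Set.Ioo t u := by
  obtain ⟨m, hm⟩ := exists_pow_lt_of_lt_one (tsub_pos_of_lt hu) (show (1 / 2 : ℝ≥0) < 1 by
    rw [div_lt_one (by norm_num)]; norm_num)
  have hpos : (0 : ℝ≥0) < 2 ^ m := by positivity
  have h1 : t * 2 ^ m < (⌊t * 2 ^ m⌋₊ : ℝ≥0) + 1 := Nat.lt_floor_add_one _
  have h2 : (⌊t * 2 ^ m⌋₊ : ℝ≥0) ≤ t * 2 ^ m := Nat.floor_le zero_le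
  have h3 : t * 2 ^ m < (n + 1) * 2 ^ m := by gcongr
  refine ⟨m, ⌊t * 2 ^ m⌋₊ + 1, Finset.mem_Icc.2 ⟨?_, ?_⟩, ?_, ?_⟩
  · refine le_trans (Nat.le_floor ?_) (Nat.le_succ _)
    push_cast
    gcongr
  · refine Nat.succ_le_of_lt ?_
    have := h2.trans_lt h3
    exact_mod_cast this
  · rw [dyadicTime, lt_div_iff₀ hpos]
    exact_mod_cast h1
  · rw [dyadicTime, div_lt_iff₀ hpos]
    push_cast
    have h4 : (1 : ℝ≥0) < (u - t) * 2 ^ m := by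
      rw [one_div, inv_pow] at hm
      exact (inv_lt_iff_one_lt_mul₀ hpos).1 hm
    calc (⌊t * 2 ^ m⌋₊ : ℝ≥0) + 1 < t * 2 ^ m + (u - t) * 2 ^ m := add_lt_add_of_le_of_lt h2 h4
      _ = u * 2 ^ m := by rw [← add_mul, add_tsub_cancel_of_le hu.le]

lemma IsLevyProcess.isTransient [IsProbabilityMeasure P] (hLP : IsLevyProcess L P)
    (hS : IsSymmetricProcess L P)
    (hsum : ∀ R : ℝ, Summable fun n : ℕ => P.real {ω | |L n ω| ≤ R}) : IsTransient L P := by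
  obtain ⟨K, hK⟩ := hLP.exists_half_le_measureReal hS
  -- `L 0` vanishes only almost surely, so it is subtracted here to match the telescoping sum of
  -- increments exactly.
  let E : ℝ → ℕ → ℕ → Set Ω := fun R n m =>
    {ω | ∃ k ∈ Finset.Icc (n * 2 ^ m) ((n + 1) * 2 ^ m), |L (dyadicTime m k) ω - L 0 ω| ≤ R}
  have hEm : ∀ R n m, P.real (E R n m) ≤ 2 * P.real {ω | |L (n + 1 : ℕ) ω| ≤ R + K} := by
    intro R n m
    have hd0 : dyadicTime m 0 = 0 := by simp [dyadicTime]
    have hr : ∀ k ω, ∑ i ∈ Finset.range k, (L (dyadicTime m (i + 1)) ω - L (dyadicTime m i) ω) =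
        L (dyadicTime m k) ω - L 0 ω := fun k ω => by
      rw [Finset.sum_range_sub (fun i => L (dyadicTime m i) ω), hd0]
    have hI : ∀ k ≤ (n + 1) * 2 ^ m, ∀ ω, ∑ i ∈ Finset.Ico k ((n + 1) * 2 ^ m),
        (L (dyadicTime m (i + 1)) ω - L (dyadicTime m i) ω) =
        L (dyadicTime m ((n + 1) * 2 ^ m)) ω - L (dyadicTime m k) ω := fun k hk ω => by
      rw [Finset.sum_Ico_eq_sub _ hk, hr, hr]
      ring
    have h1 := measureReal_exists_abs_sum_le (P := P)
      (fun i => (hLP.measurable (dyadicTime m (i + 1))).sub (hLP.measurable (dyadicTime m i)))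
      (hLP.indep.nat (dyadicTime_mono m)) (a := n * 2 ^ m) (M := (n + 1) * 2 ^ m) (R := R) (K := K)
      (fun k hk => by
        rw [Finset.mem_Icc] at hk
        simp only [Pi.sub_apply, hI k hk.2]
        refine hK _ _ (dyadicTime_mono m hk.2) ?_
        have h2 := dyadicTime_mono m hk.1
        rw [dyadicTime_mul] at h2 ⊢
        push_cast
        gcongr)
    simp only [Pi.sub_apply, hr] at h1
    refine h1.trans (le_of_eq ?_)
    rw [dyadicTime_mul]
    congr 1
    refine measureReal_congr ?_
    filter_upwards [hLP.zero] with ω hω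
    have : (|L (n + 1 : ℕ) ω - L 0 ω| ≤ R + K) = (|L (n + 1 : ℕ) ω| ≤ R + K) := by
      rw [hω, sub_zero]
    exact this
  have hmono : ∀ R n, Monotone (E R n) := fun R n => by
    refine monotone_nat_of_le_succ fun m => ?_
    rintro ω ⟨k, hk, hle⟩
    rw [Finset.mem_Icc] at hk
    refine ⟨2 * k, Finset.mem_Icc.2 ⟨?_, ?_⟩, ?_⟩
    · rw [pow_succ]; linarith [hk.1]
    · rw [pow_succ]; linarith [hk.2]
    · rwa [dyadicTime_two_mul]
  -- The bound in `hEm` does not depend on the level `m`, and the dyadic grids are nested, so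
  -- continuity from below gives it for all levels at once.
  have hE : ∀ R n, P.real (⋃ m, E R n m) ≤ 2 * P.real {ω | |L (n + 1 : ℕ) ω| ≤ R + K} := by
    intro R n
    have h1 := (ENNReal.tendsto_toReal (measure_ne_top P _)).comp
      (tendsto_measure_iUnion_atTop (μ := P) (hmono R n))
    exact le_of_tendsto' h1 (hEm R n)
  have hev : ∀ R : ℕ, ∀ᵐ ω ∂P, ∀ᶠ n in atTop, ω ∉ ⋃ m, E R n m := fun R => by
    refine ae_eventually_notMem_of_summable_measureReal ?_
    exact Summable.of_nonneg_of_le (fun _ => measureReal_nonneg) (hE R)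
      (((summable_nat_add_iff 1).2 (hsum (R + K))).mul_left 2)
  filter_upwards [ae_all_iff.2 hev, hLP.zero, hLP.cadlag] with ω hω h0 hc
  refine tendsto_atTop.2 fun b => ?_
  obtain ⟨R, hR⟩ := exists_nat_ge b
  obtain ⟨N, hN⟩ := eventually_atTop.1 (hω R)
  filter_upwards [eventually_ge_atTop (N : ℝ≥0)] with t ht
  refine hR.trans ?_
  by_contra! hlt
  -- By right-continuity `|L|` stays below `R` just after `t`, hence at some dyadic time in `[⌊t⌋,
  -- ⌊t⌋ + 1]`. That contradicts the choice of `N`, since `⌊t⌋ ≥ N`.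
  have hnear : ∀ᶠ s in 𝓝[>] t, |L s ω| < R :=
    (continuous_abs.continuousAt.tendsto.comp (hc t).1).eventually_lt_const hlt
  obtain ⟨u, hu, hsub⟩ := (mem_nhdsGT_iff_exists_Ioo_subset).1 hnear
  obtain ⟨m, k, hk, hmem⟩ := exists_dyadicTime_mem_Ioo (n := ⌊t⌋₊) (Nat.floor_le zero_le)
    (Nat.lt_floor_add_one t) hu
  refine hN ⌊t⌋₊ (Nat.le_floor ht) (Set.mem_iUnion.2 ⟨m, k, hk, ?_⟩)
  rw [h0, sub_zero]
  exact (hsub hmem : |L _ ω| < R).le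

end

theorem mainTheorem8 (α β : ℝ) (hα : 0 < α) (hα1 : α < 1) (hβ : 0 < β) :
    -- every symmetric Lévy process with this Lévy measure is transient
    (∀ (Ω : Type*) [MeasurableSpace Ω] (P : Measure Ω) [IsProbabilityMeasure P]
      (L : ℝ≥0 → Ω → ℝ), IsLevyProcess L P → IsSymmetricProcess L P →
      HasLevyMeasure L P (multiLevyMeasure α β) → IsTransient L P) ∧
    -- every random walk whose jump law is the normalised weight sequence is transient
    (∀ (Ω : Type*) [MeasurableSpace Ω] (P : Measure Ω) [IsProbabilityMeasure P]
      (p₀ : ℝ) (J : ℕ → Ω → ℤ), 0 ≤ p₀ → AreJumps J P →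
      (∀ n : ℤ, P.real {ω | J 0 ω = n} =
        (∑' m : ℤ, multiWeight α β p₀ m)⁻¹ * multiWeight α β p₀ n) →
      IsTransient (fun n ω => (randomWalk J n ω : ℝ)) P ∧ IsTransientChain J P) ∧
    -- the summability condition holds if and only if `β < 1`, so it fails for `β ≥ 1`,
    -- both for the weights of the Lévy measure and for the jump law of the walk
    (CubicCondition (fun n => (multiLevyMeasure α β).real {(n : ℝ)}) ↔ β < 1) ∧
    (∀ p₀ : ℝ, 0 ≤ p₀ →
      (CubicCondition (fun n => (∑' m : ℤ, multiWeight α β p₀ m)⁻¹ * multiWeight α β p₀ n) ↔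
        β < 1)) := by
  refine ⟨fun Ω _ P _ L hLP hS hν => ?_, fun Ω _ P _ p₀ J hp hJ hlaw => ⟨?_, ?_⟩, ?_,
    fun p₀ hp => ?_⟩
  · exact hLP.isTransient hS
      (summable_measureReal_abs_le_of_hasLevyMeasure hα hα1 hβ hLP.measurable hν)
  · exact isTransient_of_summable (summable_randomWalk hα hα1 hβ hp hJ hlaw)
  · exact isTransientChain_of_summable (summable_randomWalk hα hα1 hβ hp hJ hlaw 0)
  · simp only [multiLevyMeasure_real_singleton]
    exact cubicCondition_multiWeight_iff hα1 0
  · rw [cubicCondition_const_mul_iff (inv_ne_zero (tsum_multiWeight_pos hα hβ hp).ne')]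
    exact cubicCondition_multiWeight_iff hα1 p₀
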